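/- Corollary 1. Consider a $K$ user ADT deterministic interference network (with a single sub-channel): for $k,i\in[K]=\{1,\dots,K\}$ let $n_{ki}\ge 0$ be an integer, the strength level of the link from Transmitter $i$ to Receiver $k$. In each channel use Transmitter $i$ sends a real number $X_i\in[0,1)$, and Receiver $k$ observes $$Y_k=\lfloor 2^{n_{k1}}X_1\rfloor\oplus\lfloor 2^{n_{k2}}X_2\rfloor\oplus\cdots\oplus\lfloor 2^{n_{kK}}X_K\rfloor ,$$ where $\oplus$ is addition modulo two of each binary digit. A rate tuple $(R_1,\dots,R_K)\in\mathbb{R}_+^K$ is achievable if there are codes of block lengths $N=1,2,\dots$, in which Transmitter $i$ maps a message $W_i$ to $N$ channel inputs, the messages being independent with $W_i$ uniform on $\{1,\dots,\lceil 2^{NR_i}\rceil\}$, and Receiver $k$ estimates $W_k$ from its $N$ outputs, such that the error probability at each receiver tends to $0$ as $N\to\infty$. The capacity region $\mathcal{C}$ is the closure of the set of achievable rate tuples, and the sum-capacity is $\mathcal{C}_\Sigma=\max_{R\in\mathcal{C}}\sum_{k=1}^K R_k$. A cycle $\pi$ is a nonempty cyclically ordered set $(i_1,\dots,i_L)$ of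 distinct users. Its weight is $w(\pi)=n_{i_1i_2}+n_{i_2i_3}+\cdots+n_{i_Li_1}$ if $L\ge 2$, and $w(\pi)=0$ if $L=1$. A cyclic partition $\Pi$ is a set of pairwise disjoint cycles that together contain all $K$ users; $w(\Pi)=\sum_{\pi\in\Pi}w(\pi)$, and its cyclic partition bound is $\mathcal{C}^{\Pi}_\Sigma=\sum_{k=1}^K n_{kk}-w(\Pi)$. The best cyclic partition bound is $\mathcal{C}^{\Pi*}_\Sigma=\min_\Pi\mathcal{C}^{\Pi}_\Sigma$. Suppose that the network is TIN optimal, that is, $$n_{ii}\ \ge\ \max_{j\ne i} n_{ji}+\max_{k\ne i} n_{ik}\qquad\text{for all } i\in[K]$$ (a maximum over the empty set being $0$). Then the maximum that defines the sum-capacity exists, and $$\mathcal{C}_\Sigma\;=\;\mathcal{C}^{\Pi*}_\Sigma\;=\;\sum_{k=1}^K n_{kk}-\max_{\Pi} w(\Pi),$$ where the maximum is over all cyclic partitions $\Pi$. -/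

import Mathlib

open Filter Topology

noncomputable section

namespace ADT

/-! ### The channel -/

/-- The output at receiver `k` in one channel use. The entry `n k i` is the strength level of the
link from transmitter `i` to receiver `k`, the input `x i` is a real number in `[0, 1)`, and the
integers `⌊2 ^ (n k i) * x i⌋` are added bit by bit modulo two. -/
def output {K : ℕ} (n : Fin K → Fin K → ℕ) (x : Fin K → Set.Ico (0 : ℝ) 1) (k : Fin K) : ℕ :=
  (Finset.univ : Finset (Fin K)).fold (fun a b : ℕ => a ^^^ b) 0
    (fun i => ⌊(2 : ℝ) ^ n k i * (x i : ℝ)⌋₊)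

/-- The number of messages of a user of rate `R` at block length `N`. -/
def numMessages (N : ℕ) (R : ℝ) : ℕ := ⌈(2 : ℝ) ^ ((N : ℝ) * R)⌉₊

/-- A code of block length `N` and rates `R`. Each transmitter encodes its own message, and each
receiver estimates the message of its own transmitter from its own output sequence. -/
structure Code (K N : ℕ) (R : Fin K → ℝ) where
  enc : (i : Fin K) → Fin (numMessages N (R i)) → Fin N → Set.Ico (0 : ℝ) 1
  dec : (k : Fin K) → (Fin N → ℕ) → Fin (numMessages N (R k))

/-- The output sequence at receiver `k` when the messages `w` are sent. -/
def Code.received {K N : ℕ} {R : Fin K → ℝ} (c : Code K N R) (n : Fin K → Fin K → ℕ)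
    (w : (i : Fin K) → Fin (numMessages N (R i))) (k : Fin K) : Fin N → ℕ :=
  fun t => output n (fun i => c.enc i (w i) t) k

/-- The probability that receiver `k` decodes wrongly when the messages are independent and
uniform, that is, when the message tuple is uniform on the product of the message sets. -/
def Code.errorProb {K N : ℕ} {R : Fin K → ℝ} (c : Code K N R) (n : Fin K → Fin K → ℕ)
    (k : Fin K) : ℝ :=
  (Nat.card {w : (i : Fin K) → Fin (numMessages N (R i)) // c.dec k (c.received n w k) ≠ w k} : ℝ) /
    (Nat.card ((i : Fin K) → Fin (numMessages N (R i))) : ℝ)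

/-- A tuple of nonnegative rates is achievable if there are codes of all block lengths whose
error probabilities tend to zero at every receiver. -/
def Achievable {K : ℕ} (n : Fin K → Fin K → ℕ) (R : Fin K → ℝ) : Prop :=
  (∀ k, 0 ≤ R k) ∧
    ∃ c : (N : ℕ) → Code K N R, ∀ k, Tendsto (fun N => (c N).errorProb n k) atTop (𝓝 0)

def capacityRegion {K : ℕ} (n : Fin K → Fin K → ℕ) : Set (Fin K → ℝ) :=
  closure {R | Achievable n R}

/-- The set of values of the sum-rate on the capacity region. -/
def sumRates {K : ℕ} (n : Fin K → Fin K → ℕ) : Set ℝ :=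
  (fun R : Fin K → ℝ => ∑ k, R k) '' capacityRegion n

def sumCapacity {K : ℕ} (n : Fin K → Fin K → ℕ) : ℝ := sSup (sumRates n)

/-- `n i i ≥ max_{j ≠ i} n j i + max_{k ≠ i} n i k` for every user `i`; a maximum over the empty
set is `0`. -/
def TINOptimal {K : ℕ} (n : Fin K → Fin K → ℕ) : Prop :=
  ∀ i, (Finset.univ.filter (fun j => j ≠ i)).sup (fun j => n j i) +
    (Finset.univ.filter (fun k => k ≠ i)).sup (fun k => n i k) ≤ n i i

/-! ### Cycles and cyclic partitions -/

/-- The weight of the edge from user `j` to user `i`. -/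
def edgeWeight {K : ℕ} (n : Fin K → Fin K → ℕ) (i j : Fin K) : ℕ := if i = j then 0 else n i j

/-- A cycle of users: a nonempty cyclically ordered set of users, without repetitions. -/
abbrev UserCycle (K : ℕ) : Type := {s : Cycle (Fin K) // s.Nodup ∧ s ≠ Cycle.nil}

def UserCycle.users {K : ℕ} (c : UserCycle K) : Finset (Fin K) := c.1.toFinset

/-- The user that follows `i` in the cycle (`i` itself if the cycle is `{i}`). -/
def UserCycle.next {K : ℕ} (c : UserCycle K) (i : Fin K) : Fin K := c.1.formPerm c.2.1 i

/-- The weight of a cycle: the cycle `i₁, i₂, …, i_L` has the weight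
`w(i₁, i₂) + w(i₂, i₃) + ⋯ + w(i_L, i₁)`. -/
def UserCycle.weight {K : ℕ} (n : Fin K → Fin K → ℕ) (c : UserCycle K) : ℕ :=
  ∑ i ∈ c.users, edgeWeight n i (c.next i)

/-- A cyclic partition: a set of pairwise disjoint cycles whose cardinalities add up to `K`. -/
structure CyclicPartition (K : ℕ) where
  cycles : Finset (UserCycle K)
  disjoint : ∀ p ∈ cycles, ∀ q ∈ cycles, p ≠ q → Disjoint p.users q.users
  card_eq : ∑ p ∈ cycles, p.users.card = K

def CyclicPartition.weight {K : ℕ} (n : Fin K → Fin K → ℕ) (P : CyclicPartition K) : ℕ :=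
  ∑ p ∈ P.cycles, p.weight n

def cyclicPartitionBound {K : ℕ} (n : Fin K → Fin K → ℕ) (P : CyclicPartition K) : ℝ :=
  (∑ k, (n k k : ℝ)) - (P.weight n : ℝ)

instance (K : ℕ) : Finite (UserCycle K) :=
  Finite.of_injective (β := {s : Cycle (Fin K) // s.Nodup}) (fun c => ⟨c.1, c.2.1⟩)
    (fun a b h => Subtype.ext (by simpa using h))

instance (K : ℕ) : Finite (CyclicPartition K) :=
  Finite.of_injective (fun P : CyclicPartition K => P.cycles)
    (fun a b h => by cases a; cases b; simp_all)

instance (K : ℕ) : Fintype (CyclicPartition K) := Fintype.ofFinite _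

def trivialCycle {K : ℕ} (i : Fin K) : UserCycle K :=
  ⟨(([i] : List (Fin K)) : Cycle (Fin K)), by simp, by simp⟩

theorem users_trivialCycle {K : ℕ} (i : Fin K) : (trivialCycle i).users = {i} := by
  simp [trivialCycle, UserCycle.users]

theorem trivialCycle_injective {K : ℕ} :
    Function.Injective (trivialCycle : Fin K → UserCycle K) := by
  intro i j h
  have h2 := congrArg UserCycle.users h
  simpa [users_trivialCycle] using h2

instance (K : ℕ) : Nonempty (CyclicPartition K) :=
  ⟨{ cycles := Finset.univ.map ⟨trivialCycle, trivialCycle_injective⟩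
     disjoint := by
       intro p hp q hq hpq
       simp only [Finset.mem_map, Finset.mem_univ, true_and, Function.Embedding.coeFn_mk] at hp hq
       obtain ⟨i, rfl⟩ := hp
       obtain ⟨j, rfl⟩ := hq
       have hij : i ≠ j := fun h => hpq (by rw [h])
       simpa [users_trivialCycle] using hij
     card_eq := by simp [users_trivialCycle] }⟩

/-- The tightest of all cyclic partition bounds. -/
def bestCyclicPartitionBound {K : ℕ} (n : Fin K → Fin K → ℕ) : ℝ :=
  (Finset.univ : Finset (CyclicPartition K)).inf' Finset.univ_nonempty (cyclicPartitionBound n)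

def maxCyclicPartitionWeight {K : ℕ} (n : Fin K → Fin K → ℕ) : ℕ :=
  (Finset.univ : Finset (CyclicPartition K)).sup' Finset.univ_nonempty
    (fun P => P.weight n)

end ADT

end

namespace ADT

/-! ### Bitwise sums -/

/-! Achievability is linear programming duality. By Egerváry's theorem the maximum assignment for
the matrix `edgeWeight n` equals the minimum of `∑ (u k + v k)` over integer covers `n k i ≤ u k + v
i`. A cover is a power allocation: transmitter `i` silences at most its top `v i` levels, and the
interference at receiver `k` then stays below level `u k`. The levels in between carry uncoded bits
(`achievable_of_levels`), so the total loss is at most the weight of a permutation, whose cycles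
form a cyclic partition.

The converse treats one cycle at a time. Let `S_k` be the top `e_k` levels of the codeword of user
`k` that its predecessor on the cycle hears, and `d_k = n_kk - e_k`. TIN optimality keeps all
interference at receiver `k` below level `d_k`, so `S_k` and the lower `d_k` bits determine the
output; after correct decoding, with all other messages fixed, the output reveals `S_σ(k)`. In
entropies this reads `N R_k ≤ H(S_k) - H(S_σ(k)) + N d_k`, which telescopes around the cycle. The
proof uses a counting form: fibre sizes replace entropies (`Code.card_unlikely_le`), and a union
bound yields one message tuple for which the inequalities for all users hold up to a factor `δ`
(`Code.prod_numMessages_le`). This factor vanishes in the rate as `N → ∞`. -/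

theorem fold_xor_eq_xor_erase {ι : Type*} [DecidableEq ι] (s : Finset ι) (f : ι → ℕ) {k : ι}
    (hk : k ∈ s) :
    s.fold (fun a b : ℕ => a ^^^ b) 0 f =
      f k ^^^ (s.erase k).fold (fun a b : ℕ => a ^^^ b) 0 f := by
  conv_lhs => rw [← Finset.insert_erase hk]
  rw [Finset.fold_insert (Finset.notMem_erase k s)]

theorem fold_xor_eq_zero {ι : Type*} [DecidableEq ι] (s : Finset ι) (f : ι → ℕ)
    (h : ∀ i ∈ s, f i = 0) : s.fold (fun a b : ℕ => a ^^^ b) 0 f = 0 := by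
  induction s using Finset.induction_on with
  | empty => simp
  | insert a s ha ih =>
    rw [Finset.fold_insert ha, h a (by simp), ih fun i hi => h i (by simp [hi])]
    rfl

/-- Division by `2 ^ d` is a right shift, which acts on each binary digit separately. -/
theorem fold_xor_div_two_pow {ι : Type*} (s : Finset ι) (f : ι → ℕ) (d : ℕ) :
    s.fold (fun a b : ℕ => a ^^^ b) 0 f / 2 ^ d =
      s.fold (fun a b : ℕ => a ^^^ b) 0 (fun i => f i / 2 ^ d) := by
  have h := Finset.fold_hom (op := fun a b : ℕ => a ^^^ b) (op' := fun a b : ℕ => a ^^^ b)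
    (m := fun a => a / 2 ^ d) (f := f) (b := 0) (s := s)
    (fun x y => by simp only [← Nat.shiftRight_eq_div_pow, Nat.shiftRight_xor_distrib])
  simpa using h.symm

theorem fold_xor_div_two_pow_eq {ι : Type*} [DecidableEq ι] (s : Finset ι) (f : ι → ℕ) (d : ℕ)
    {k : ι} (hk : k ∈ s) (h : ∀ i ∈ s, i ≠ k → f i < 2 ^ d) :
    s.fold (fun a b : ℕ => a ^^^ b) 0 f / 2 ^ d = f k / 2 ^ d := by
  rw [fold_xor_div_two_pow, fold_xor_eq_xor_erase s _ hk, fold_xor_eq_zero]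
  · simp
  · intro i hi
    exact Nat.div_eq_of_lt (h i (Finset.mem_of_mem_erase hi) (Finset.ne_of_mem_erase hi))

theorem fold_xor_cancel {ι : Type*} [DecidableEq ι] (s : Finset ι) (f g : ι → ℕ) {j : ι}
    (hj : j ∈ s) (hfg : ∀ i ∈ s, i ≠ j → f i = g i)
    (h : s.fold (fun a b : ℕ => a ^^^ b) 0 f = s.fold (fun a b : ℕ => a ^^^ b) 0 g) :
    f j = g j := by
  rw [fold_xor_eq_xor_erase s f hj, fold_xor_eq_xor_erase s g hj,
    Finset.fold_congr (g := g) fun i hi =>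
      hfg i (Finset.mem_of_mem_erase hi) (Finset.ne_of_mem_erase hi)] at h
  exact Nat.xor_left_injective h

/-! ### Levels of a real input -/

theorem floor_two_pow_mul_lt (x : Set.Ico (0 : ℝ) 1) (a : ℕ) :
    ⌊(2 : ℝ) ^ a * (x : ℝ)⌋₊ < 2 ^ a := by
  rw [Nat.floor_lt (mul_nonneg (by positivity) x.2.1)]
  push_cast
  exact mul_lt_of_lt_one_right (by positivity) x.2.2

theorem floor_two_pow_mul_div (x : ℝ) (a b : ℕ) :
    ⌊(2 : ℝ) ^ (a + b) * x⌋₊ / 2 ^ b = ⌊(2 : ℝ) ^ a * x⌋₊ := by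
  have h := Nat.floor_div_natCast ((2 : ℝ) ^ (a + b) * x) (2 ^ b)
  rw [← h]
  congr 1
  push_cast
  field_simp
  ring

/-- The part of the output above level `d` is the part of the desired signal above level `d`,
if no interfering link is stronger than `d`. -/
theorem output_div_two_pow {K : ℕ} (n : Fin K → Fin K → ℕ) (x : Fin K → Set.Ico (0 : ℝ) 1)
    (k : Fin K) (e d : ℕ) (hd : n k k = e + d) (h : ∀ i, i ≠ k → n k i ≤ d) :
    output n x k / 2 ^ d = ⌊(2 : ℝ) ^ e * (x k : ℝ)⌋₊ := by
  rw [output, fold_xor_div_two_pow_eq _ _ d (Finset.mem_univ k), hd, floor_two_pow_mul_div]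
  intro i _ hi
  exact (floor_two_pow_mul_lt (x i) _).trans_le (Nat.pow_le_pow_right (by norm_num) (h i hi))

/-! ### Counting -/

/-- Exchanging `w k` with the fresh coordinate `u` is an involution on the pairs `(w, u)`.
Resampling a coordinate thus preserves counts, which lets a bound with the other messages frozen be
averaged over all tuples. -/
theorem sum_sum_update {ι : Type*} [Fintype ι] [DecidableEq ι] {α : ι → Type*}
    [∀ i, Fintype (α i)] (k : ι) (f : (∀ i, α i) → ℝ) :
    ∑ w, ∑ u : α k, f (Function.update w k u) = Fintype.card (α k) * ∑ w, f w := by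
  have hswap : ∑ p : (∀ i, α i) × α k, f (Function.update p.1 k p.2) =
      ∑ p : (∀ i, α i) × α k, f p.1 := by
    refine Finset.sum_bij' (fun p _ => (Function.update p.1 k p.2, p.1 k))
      (fun p _ => (Function.update p.1 k p.2, p.1 k)) ?_ ?_ ?_ ?_ ?_ <;> simp
  rw [← Fintype.sum_prod_type' (f := fun w u => f (Function.update w k u)), hswap,
    Fintype.sum_prod_type' (f := fun w _ => f w)]
  simp [Finset.mul_sum]

/-- If, on a set `B` of pairs, the pair `(u, g v)` is determined by `f u` and a further
observation `Z u v`, and the `g`-fibres are small compared with the `f`-fibres, then `B` is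
small. -/
theorem card_small_fiber_le {α α' β γ ζ : Type*} [Fintype α] [Fintype α'] [Fintype ζ]
    [DecidableEq α] [DecidableEq α'] [DecidableEq β] [DecidableEq γ] [DecidableEq ζ]
    (f : α → β) (g : α' → γ) (Z : α → α' → ζ) (B : Finset (α × α')) {c : ℝ}
    (hc : 0 ≤ c)
    (hinj : ∀ p ∈ B, ∀ q ∈ B, f p.1 = f q.1 → Z p.1 p.2 = Z q.1 q.2 →
      p.1 = q.1 ∧ g p.2 = g q.2)
    (hB : ∀ p ∈ B, ((Finset.univ.filter fun v => g v = g p.2).card : ℝ) * Fintype.card ζ ≤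
      c * (Finset.univ.filter fun u => f u = f p.1).card) :
    (B.card : ℝ) ≤ c * Fintype.card α := by
  classical
  have hf : ∀ s : β, ((B.filter fun p => f p.1 = s).card : ℝ) ≤
      c * (Finset.univ.filter fun u => f u = s).card := by
    intro s
    rcases isEmpty_or_nonempty ζ with hζ | hζ
    · have : B.filter (fun p => f p.1 = s) = ∅ :=
        Finset.eq_empty_of_forall_notMem fun p _ => hζ.elim (Z p.1 p.2)
      rw [this]
      simp only [Finset.card_empty, Nat.cast_zero]
      positivity
    have hD : (0 : ℝ) < Fintype.card ζ := by exact_mod_cast Fintype.card_pos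
    -- Once `f u = s` and `Z u v = z` are fixed, all remaining pairs share the same `u`, and their
    -- second entries lie in a single `g`-fibre.
    have hz : ∀ z : ζ, (((B.filter fun p => f p.1 = s).filter fun p => Z p.1 p.2 = z).card : ℝ) ≤
        c * (Finset.univ.filter fun u => f u = s).card / Fintype.card ζ := by
      intro z
      set T := (B.filter fun p => f p.1 = s).filter fun p => Z p.1 p.2 = z with hT
      rcases T.eq_empty_or_nonempty with h0 | ⟨p, hp⟩
      · rw [h0]
        simp only [Finset.card_empty, Nat.cast_zero]
        positivity
      · have hp' := hp
        simp only [hT, Finset.mem_filter] at hp'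
        have hsub : T.card ≤ (Finset.univ.filter fun v => g v = g p.2).card := by
          refine Finset.card_le_card_of_injOn Prod.snd ?_ ?_
          · intro q hq
            simp only [hT, Finset.coe_filter, Set.mem_ofPred_eq, Finset.mem_filter] at hq
            simpa using (hinj q hq.1.1 p hp'.1.1 (by rw [hq.1.2, hp'.1.2])
              (by rw [hq.2, hp'.2])).2
          · intro q hq q' hq' h
            simp only [hT, Finset.coe_filter, Set.mem_ofPred_eq, Finset.mem_filter] at hq hq'
            exact Prod.ext (hinj q hq.1.1 q' hq'.1.1 (by rw [hq.1.2, hq'.1.2])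
              (by rw [hq.2, hq'.2])).1 h
        rw [le_div_iff₀ hD]
        have h1 := hB p hp'.1.1
        rw [hp'.1.2] at h1
        refine le_trans ?_ h1
        gcongr
    rw [Finset.card_eq_sum_card_fiberwise (f := fun p => Z p.1 p.2) (t := Finset.univ)
      (fun _ _ => by simp)]
    push_cast
    refine (Finset.sum_le_sum fun z _ => hz z).trans ?_
    rw [Finset.sum_const, nsmul_eq_mul, Finset.card_univ]
    field_simp
    exact le_rfl
  rw [Finset.card_eq_sum_card_fiberwise (f := fun p => f p.1) (t := Finset.univ.image f)
      (fun _ _ => by simp), ← Finset.card_univ,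
    Finset.card_eq_sum_card_fiberwise (f := f) (s := Finset.univ) (t := Finset.univ.image f)
      (fun _ _ => by simp)]
  push_cast
  rw [Finset.mul_sum]
  exact Finset.sum_le_sum fun s _ => hf s

/-! ### Duality for the assignment problem -/

/-- Egerváry's theorem: an integer weight matrix has a permutation and an integer cover of the
same total weight. -/
theorem exists_perm_cover {K : ℕ} (w : Fin K → Fin K → ℤ) :
    ∃ (σ : Equiv.Perm (Fin K)) (u v : Fin K → ℤ), (∀ k j, w k j ≤ u k + v j) ∧
      ∑ k, (u k + v k) = ∑ k, w k (σ k) := by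
  classical
  -- The diagonal weight is a lower bound for every cover, so the excess over it is a natural number
  -- and can be minimized.
  let P : ℕ → Prop := fun m => ∃ u v : Fin K → ℤ, (∀ k j, w k j ≤ u k + v j) ∧
    ∑ k, (u k + v k) = ∑ k, w k k + m
  have hP : ∃ m, P m := by
    let u : Fin K → ℤ := fun k => ∑ j, |w k j|
    have hu : ∀ k j, w k j ≤ u k + 0 := fun k j => by
      rw [add_zero]
      exact (le_abs_self _).trans
        (Finset.single_le_sum (f := fun j => |w k j|) (fun _ _ => abs_nonneg _) (Finset.mem_univ j))
    refine ⟨(∑ k, (u k + 0) - ∑ k, w k k).toNat, u, fun _ => 0, hu, ?_⟩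
    have : ∑ k, w k k ≤ ∑ k, (u k + 0) := Finset.sum_le_sum fun k _ => hu k k
    rw [Int.toNat_of_nonneg (by linarith)]
    ring
  obtain ⟨u, v, huv, hsum⟩ := Nat.find_spec hP
  let T : Fin K → Finset (Fin K) := fun k => Finset.univ.filter fun j => w k j = u k + v j
  -- Hall's condition for the graph of tight entries. If it failed on `s`, lowering `u` by one on
  -- `s` and raising `v` by one on the neighbours of `s` would give a smaller cover.
  have hall : ∀ s : Finset (Fin K), s.card ≤ (s.biUnion T).card := by
    intro s
    by_contra! hlt
    let u' : Fin K → ℤ := fun k => u k - if k ∈ s then 1 else 0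
    let v' : Fin K → ℤ := fun j => v j + if j ∈ s.biUnion T then 1 else 0
    have hu'v' : ∀ k j, w k j ≤ u' k + v' j := by
      intro k j
      have h := huv k j
      simp only [u', v']
      by_cases hk : k ∈ s
      · by_cases hj : j ∈ s.biUnion T
        · simp only [hk, hj, if_true]; linarith
        · have hne : w k j ≠ u k + v j := fun he =>
            hj (Finset.mem_biUnion.2 ⟨k, hk, by simp [T, he]⟩)
          -- Integrality: an entry that is not tight has slack at least one, which absorbs the
          -- decrease of `u k`.
          have := lt_of_le_of_ne h hne
          simp only [hk, hj, if_true, if_false]; omega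
      · simp only [hk, if_false]; split_ifs <;> linarith
    have hsum' : ∑ k, (u' k + v' k) = ∑ k, (u k + v k) - s.card + (s.biUnion T).card := by
      have h1 : ∑ k : Fin K, (if k ∈ s then (1 : ℤ) else 0) = s.card := by simp
      have h2 : ∑ k : Fin K, (if k ∈ s.biUnion T then (1 : ℤ) else 0) = (s.biUnion T).card := by
        rw [Finset.sum_boole, Finset.filter_univ_mem]
      simp only [u', v', Finset.sum_add_distrib, Finset.sum_sub_distrib, h1, h2]
      ring
    have hge : ∑ k, w k k ≤ ∑ k, (u' k + v' k) := Finset.sum_le_sum fun k _ => hu'v' k k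
    refine Nat.find_min hP (m := (∑ k, (u' k + v' k) - ∑ k, w k k).toNat) ?_
      ⟨u', v', hu'v', ?_⟩ <;> omega
  obtain ⟨f, hf, hfT⟩ := (Finset.all_card_le_biUnion_card_iff_exists_injective T).1 hall
  refine ⟨Equiv.ofBijective f (Finite.injective_iff_bijective.1 hf), u, v, huv, ?_⟩
  have h : ∀ k, w k (f k) = u k + v (f k) := fun k => by simpa [T] using hfT k
  simp only [Equiv.ofBijective_apply, h, Finset.sum_add_distrib]
  congr 1
  exact (Equiv.sum_comp (Equiv.ofBijective f (Finite.injective_iff_bijective.1 hf)) v).symm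

/-- Moving the constant `min u` from `u` to `v` changes no sum `u k + v j`. Afterwards `u` is
nonnegative, and so is `v`, since `u` vanishes at the minimizer `k₀` and the weights are
nonnegative. -/
theorem exists_perm_nonneg_cover {K : ℕ} (w : Fin K → Fin K → ℕ) :
    ∃ (σ : Equiv.Perm (Fin K)) (u v : Fin K → ℕ), (∀ k j, w k j ≤ u k + v j) ∧
      ∑ k, (u k + v k) = ∑ k, w k (σ k) := by
  obtain ⟨σ, u, v, huv, hsum⟩ := exists_perm_cover fun k j => (w k j : ℤ)
  rcases isEmpty_or_nonempty (Fin K) with hK | hK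
  · exact ⟨σ, fun _ => 0, fun _ => 0, fun k => hK.elim k, by simp⟩
  obtain ⟨k₀, hk₀⟩ := Finite.exists_min u
  have hu : ∀ k, 0 ≤ u k - u k₀ := fun k => sub_nonneg.2 (hk₀ k)
  have hv : ∀ j, 0 ≤ v j + u k₀ := fun j => by have := huv k₀ j; omega
  refine ⟨σ, fun k => (u k - u k₀).toNat, fun j => (v j + u k₀).toNat, ?_, ?_⟩
  · intro k j
    have := huv k j
    dsimp only
    omega
  · zify
    rw [← hsum]
    refine Finset.sum_congr rfl fun k _ => ?_
    rw [Int.toNat_of_nonneg (hu k), Int.toNat_of_nonneg (hv k)]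
    ring

/-! ### Treating interference as noise -/

theorem numMessages_natCast (N r : ℕ) : numMessages N (r : ℝ) = 2 ^ (N * r) := by
  rw [numMessages, ← Nat.cast_mul, Real.rpow_natCast]
  exact_mod_cast Nat.ceil_natCast (R := ℝ) (2 ^ (N * r))

/-- If transmitter `i` leaves its top `r i` levels unused and the interference at receiver `k`
stays below level `q k`, then all levels in between carry uncoded bits without errors. -/
theorem achievable_of_levels {K : ℕ} (n : Fin K → Fin K → ℕ) (r q ρ : Fin K → ℕ)
    (hρ : ∀ k, n k k = ρ k + r k + q k) (hq : ∀ k i, i ≠ k → n k i ≤ q k + r i) :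
    Achievable n (fun k => (ρ k : ℝ)) := by
  have hcard : ∀ N i, Fintype.card (Fin (numMessages N (ρ i : ℝ))) =
      Fintype.card (Fin N → Fin (2 ^ ρ i)) := fun N i => by
    simp [numMessages_natCast, ← pow_mul, mul_comm]
  let e : ∀ N i, Fin (numMessages N (ρ i : ℝ)) ≃ (Fin N → Fin (2 ^ ρ i)) :=
    fun N i => Fintype.equivOfCardEq (hcard N i)
  have hlt : ∀ (i : Fin K) (m : Fin (2 ^ ρ i)), (m : ℝ) / 2 ^ (ρ i + r i) < 1 / 2 ^ r i := by
    intro i m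
    have hm : (m : ℝ) < 2 ^ ρ i := by exact_mod_cast m.2
    rw [div_lt_div_iff₀ (by positivity) (by positivity), pow_add, one_mul]
    gcongr
  -- The binary expansion of this input consists of `r i` zeros followed by the `ρ i` digits of `m`.
  let x : ∀ i, Fin (2 ^ ρ i) → Set.Ico (0 : ℝ) 1 := fun i m =>
    ⟨(m : ℝ) / 2 ^ (ρ i + r i), by positivity, (hlt i m).trans_le
      ((div_le_one (by positivity)).2 (one_le_pow₀ (by norm_num)))⟩
  have hout : ∀ (m : ∀ i, Fin (2 ^ ρ i)) (k : Fin K),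
      output n (fun i => x i (m i)) k / 2 ^ q k = m k := by
    intro m k
    rw [output, fold_xor_div_two_pow_eq _ _ (q k) (Finset.mem_univ k), hρ k,
      floor_two_pow_mul_div]
    · simp only [x]
      rw [mul_div_cancel₀ _ (by positivity)]
      exact Nat.floor_natCast _
    · intro i _ hi
      rw [Nat.floor_lt (mul_nonneg (by positivity) (x i (m i)).2.1)]
      have hpow : (2 : ℝ) ^ n k i ≤ 2 ^ (q k + r i) := pow_le_pow_right₀ (by norm_num) (hq k i hi)
      calc (2 : ℝ) ^ n k i * (x i (m i) : ℝ) < 2 ^ n k i * (1 / 2 ^ r i) := by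
            have := hlt i (m i)
            simp only [x]
            gcongr
        _ ≤ 2 ^ (q k + r i) * (1 / 2 ^ r i) := by gcongr
        _ = ((2 ^ q k : ℕ) : ℝ) := by
            push_cast
            rw [pow_add]
            field_simp
  refine ⟨fun k => Nat.cast_nonneg _, fun N =>
    { enc := fun i m t => x i (e N i m t)
      dec := fun k y => (e N k).symm fun t =>
        -- The reduction modulo `2 ^ ρ k` only makes the value an element of `Fin`; by `hout` it
        -- changes nothing on actual outputs.
        ⟨y t / 2 ^ q k % 2 ^ ρ k, Nat.mod_lt _ (by positivity)⟩ }, fun k => ?_⟩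
  refine tendsto_const_nhds.congr fun N => ?_
  have hnone : IsEmpty {w : (i : Fin K) → Fin (numMessages N (ρ i : ℝ)) //
      (e N k).symm (fun t => (⟨output n (fun i => x i (e N i (w i) t)) k / 2 ^ q k % 2 ^ ρ k,
        Nat.mod_lt _ (by positivity)⟩ : Fin (2 ^ ρ k))) ≠ w k} := by
    refine ⟨fun w => w.2 ?_⟩
    rw [Equiv.symm_apply_eq]
    funext t
    refine Fin.ext ?_
    simp only [hout (fun i => e N i (w.1 i) t) k]
    exact Nat.mod_eq_of_lt (e N k (w.1 k) t).2
  have h0 := Nat.card_eq_zero.2 (Or.inl hnone)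
  simp only [Code.errorProb, Code.received]
  rw [h0]
  simp

theorem TINOptimal.add_le {K : ℕ} {n : Fin K → Fin K → ℕ} (hn : TINOptimal n) {i j k : Fin K}
    (hj : j ≠ i) (hk : k ≠ i) : n j i + n i k ≤ n i i :=
  (add_le_add (Finset.le_sup (f := fun j => n j i) (by simp [hj]))
    (Finset.le_sup (f := fun k => n i k) (by simp [hk]))).trans (hn i)

/-- Some permutation's weight is made up by the losses of an achievable rate tuple. -/
theorem exists_perm_achievable {K : ℕ} (n : Fin K → Fin K → ℕ) (hn : TINOptimal n) :
    ∃ (σ : Equiv.Perm (Fin K)) (R : Fin K → ℝ), Achievable n R ∧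
      (∑ k, (n k k : ℝ)) - ((∑ k, edgeWeight n k (σ k) : ℕ) : ℝ) ≤ ∑ k, R k := by
  obtain ⟨σ, u, v, huv, hsum⟩ := exists_perm_nonneg_cover (edgeWeight n)
  -- Silencing more levels than any unintended receiver hears is useless. This truncation of `v i`,
  -- together with TIN optimality, gives `r k + q k ≤ n k k`, while `q k ≤ u k` still holds because
  -- a truncated `r i` removes the interference of `i` completely.
  let r : Fin K → ℕ := fun i =>
    min (v i) ((Finset.univ.filter (fun j => j ≠ i)).sup (fun j => n j i))
  let q : Fin K → ℕ := fun k => (Finset.univ.filter (fun i => i ≠ k)).sup (fun i => n k i - r i)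
  have hr : ∀ i, r i ≤ v i := fun i => min_le_left _ _
  have hq : ∀ k, q k ≤ u k := by
    refine fun k => Finset.sup_le fun i hi => ?_
    have hik : i ≠ k := by simpa using hi
    have h1 : n k i ≤ u k + v i := by
      have := huv k i
      rwa [edgeWeight, if_neg hik.symm] at this
    have h2 : n k i ≤ (Finset.univ.filter (fun j => j ≠ i)).sup (fun j => n j i) :=
      Finset.le_sup (f := fun j => n j i) (by simp [hik.symm])
    simp only [r]
    omega
  have hrq : ∀ k, r k + q k ≤ n k k := fun k =>
    (add_le_add (min_le_right _ _) (Finset.sup_mono_fun fun i _ => Nat.sub_le _ _)).trans (hn k)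
  refine ⟨σ, _, achievable_of_levels n r q (fun k => n k k - (r k + q k)) (fun k => ?_)
    (fun k i hi => ?_), ?_⟩
  · have := hrq k
    omega
  · have : n k i - r i ≤ q k := Finset.le_sup (f := fun i => n k i - r i) (by simp [hi])
    omega
  · rw [← hsum, Nat.cast_sum, ← Finset.sum_sub_distrib]
    refine Finset.sum_le_sum fun k _ => ?_
    rw [Nat.cast_sub (hrq k)]
    have : ((r k + q k : ℕ) : ℝ) ≤ (u k + v k : ℕ) := by
      have := hr k
      have := hq k
      exact_mod_cast (by omega)
    linarith

/-! ### Permutations and cyclic partitions -/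

/-- The cycle of a permutation through a given user. -/
def cycleThrough {K : ℕ} (σ : Equiv.Perm (Fin K)) (k : Fin K) : UserCycle K :=
  -- For a fixed point `σ.toList k` is empty, whereas a `UserCycle` must be nonempty.
  if h : σ k = k then trivialCycle k
  else ⟨(σ.toList k : Cycle (Fin K)), by simpa using σ.nodup_toList k, by
    simpa [Equiv.Perm.toList_eq_nil_iff] using h⟩

theorem mem_users_cycleThrough {K : ℕ} (σ : Equiv.Perm (Fin K)) (k i : Fin K) :
    i ∈ (cycleThrough σ k).users ↔ σ.SameCycle k i := by
  unfold cycleThrough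
  split_ifs with h
  · rw [users_trivialCycle, Finset.mem_singleton]
    refine ⟨fun hi => hi ▸ Equiv.Perm.SameCycle.refl σ k, fun hi => ?_⟩
    exact (hi.eq_of_left h).symm
  · simp [UserCycle.users, Equiv.Perm.mem_toList_iff, h]

theorem cycleThrough_eq {K : ℕ} (σ : Equiv.Perm (Fin K)) {k i : Fin K} (h : σ.SameCycle k i) :
    cycleThrough σ k = cycleThrough σ i := by
  by_cases hk : σ k = k
  · rw [h.eq_of_left hk]
  · have hi : σ i ≠ i := fun hi => hk (h.apply_eq_self_iff.2 hi)
    simp only [cycleThrough, hk, hi, dite_false]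
    exact Subtype.ext (Cycle.coe_eq_coe.2 h.toList_isRotated)

theorem next_cycleThrough {K : ℕ} (σ : Equiv.Perm (Fin K)) (k : Fin K) :
    (cycleThrough σ k).next k = σ k := by
  by_cases hk : σ k = k
  · simp only [cycleThrough, hk, dite_true]
    change ([k] : List (Fin K)).formPerm k = k
    simp
  · simp only [cycleThrough, hk, dite_false]
    change (σ.toList k).formPerm k = σ k
    rw [Equiv.Perm.formPerm_toList, Equiv.Perm.cycleOf_apply_self]

theorem disjoint_cyclesOfPerm {K : ℕ} [DecidableEq (UserCycle K)] (σ : Equiv.Perm (Fin K)) :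
    ∀ p ∈ Finset.univ.image (cycleThrough σ), ∀ q ∈ Finset.univ.image (cycleThrough σ),
      p ≠ q → Disjoint p.users q.users := by
  intro p hp q hq hpq
  simp only [Finset.mem_image, Finset.mem_univ, true_and] at hp hq
  obtain ⟨i, rfl⟩ := hp
  obtain ⟨j, rfl⟩ := hq
  rw [Finset.disjoint_left]
  intro a ha hb
  rw [mem_users_cycleThrough] at ha hb
  exact hpq (cycleThrough_eq σ (ha.trans hb.symm))

/-- The partition of the users into the cycles of a permutation. -/
def partitionOfPerm {K : ℕ} (σ : Equiv.Perm (Fin K)) : CyclicPartition K where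
  cycles := by classical exact Finset.univ.image (cycleThrough σ)
  disjoint := by classical exact disjoint_cyclesOfPerm σ
  card_eq := by
    classical
    rw [← Finset.card_biUnion]
    · have : (Finset.univ.image (cycleThrough σ)).biUnion UserCycle.users = Finset.univ := by
        refine Finset.eq_univ_of_forall fun i => Finset.mem_biUnion.2
          ⟨cycleThrough σ i, Finset.mem_image_of_mem _ (Finset.mem_univ i), ?_⟩
        exact (mem_users_cycleThrough σ i i).2 (Equiv.Perm.SameCycle.refl σ i)
      rw [this, Finset.card_univ, Fintype.card_fin]
    · exact disjoint_cyclesOfPerm σ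

theorem CyclicPartition.biUnion_users {K : ℕ} (P : CyclicPartition K) :
    P.cycles.biUnion UserCycle.users = Finset.univ := by
  rw [← Finset.card_eq_iff_eq_univ, Finset.card_biUnion P.disjoint, P.card_eq, Fintype.card_fin]

theorem CyclicPartition.sum_cycles {K : ℕ} {M : Type*} [AddCommMonoid M] (P : CyclicPartition K)
    (f : Fin K → M) : ∑ p ∈ P.cycles, ∑ i ∈ p.users, f i = ∑ i, f i := by
  rw [← P.biUnion_users, Finset.sum_biUnion P.disjoint]

theorem weight_partitionOfPerm {K : ℕ} (n : Fin K → Fin K → ℕ) (σ : Equiv.Perm (Fin K)) :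
    (partitionOfPerm σ).weight n = ∑ k, edgeWeight n k (σ k) := by
  classical
  rw [← (partitionOfPerm σ).sum_cycles]
  refine Finset.sum_congr rfl fun p hp => Finset.sum_congr rfl fun i hi => ?_
  simp only [partitionOfPerm, Finset.mem_image, Finset.mem_univ, true_and] at hp
  obtain ⟨k, rfl⟩ := hp
  rw [cycleThrough_eq σ ((mem_users_cycleThrough σ k i).1 hi), next_cycleThrough]

/-! ### The converse -/

theorem numMessages_pos (N : ℕ) (R : ℝ) : 0 < numMessages N R :=
  Nat.ceil_pos.2 (Real.rpow_pos_of_pos (by norm_num) _)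

/-- TIN optimality enters the converse here: at receiver `i`, the levels of the desired signal that
receiver `j` also hears lie above all interference. For `j = i` there are no such levels, and only
`n i k ≤ n i i` is left. -/
theorem TINOptimal.edgeWeight_add_le {K : ℕ} {n : Fin K → Fin K → ℕ} (hn : TINOptimal n)
    (j : Fin K) {i k : Fin K} (hk : k ≠ i) : edgeWeight n j i + n i k ≤ n i i := by
  unfold edgeWeight
  split_ifs with h
  · rw [zero_add]
    exact (Nat.le_add_left _ _).trans (hn.add_le hk hk)
  · exact hn.add_le h hk

theorem TINOptimal.edgeWeight_le {K : ℕ} {n : Fin K → Fin K → ℕ} (hn : TINOptimal n)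
    (j i : Fin K) : edgeWeight n j i ≤ n i i := by
  unfold edgeWeight
  split_ifs with h
  · exact Nat.zero_le _
  · exact (Nat.le_add_right _ _).trans (hn.add_le h h)

/-- The top `e` levels of the codeword of a message. -/
noncomputable def Code.topLevels {K N : ℕ} {R : Fin K → ℝ} (c : Code K N R) (e : ℕ) (i : Fin K)
    (v : Fin (numMessages N (R i))) : Fin N → ℕ :=
  fun t => ⌊(2 : ℝ) ^ e * (c.enc i v t : ℝ)⌋₊

/-- The number of messages of transmitter `i` whose codewords have the same top `e` levels as
the message `v`. -/
noncomputable def Code.fiberCard {K N : ℕ} {R : Fin K → ℝ} (c : Code K N R) (e : ℕ) (i : Fin K)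
    (v : Fin (numMessages N (R i))) : ℕ :=
  (Finset.univ.filter fun v' => c.topLevels e i v' = c.topLevels e i v).card

theorem Code.fiberCard_pos {K N : ℕ} {R : Fin K → ℝ} (c : Code K N R) (e : ℕ) (i : Fin K)
    (v : Fin (numMessages N (R i))) : 0 < c.fiberCard e i v :=
  Finset.card_pos.2 ⟨v, by simp⟩

/-- Used for cycles of length one: the edge weight is then zero and all messages form a single
fibre. -/
theorem Code.topLevels_zero {K N : ℕ} {R : Fin K → ℝ} (c : Code K N R) (i : Fin K)
    (v v' : Fin (numMessages N (R i))) : c.topLevels 0 i v = c.topLevels 0 i v' := by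
  funext t
  have h (v) := floor_two_pow_mul_lt (c.enc i v t) 0
  simp only [pow_zero, Nat.lt_one_iff] at h
  simp only [Code.topLevels, pow_zero, h]

/-- Two message tuples that agree outside `k` and `j`, that receiver `k` decodes correctly, and
that agree in the top levels of transmitter `k` and in the lower levels of the output, agree in the
message of `k` and in what receiver `k` hears from transmitter `j`. -/
theorem Code.eq_of_received_mod_eq {K N : ℕ} {R : Fin K → ℝ} (c : Code K N R)
    {n : Fin K → Fin K → ℕ} {k j : Fin K} {e d : ℕ} (hd : n k k = e + d)
    (hint : ∀ i, i ≠ k → n k i ≤ d) {w w' : (i : Fin K) → Fin (numMessages N (R i))}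
    (hw : c.dec k (c.received n w k) = w k) (hw' : c.dec k (c.received n w' k) = w' k)
    (hoff : ∀ i, i ≠ k → i ≠ j → w i = w' i)
    (htop : c.topLevels e k (w k) = c.topLevels e k (w' k))
    (hmod : ∀ t, c.received n w k t % 2 ^ d = c.received n w' k t % 2 ^ d) :
    w k = w' k ∧ (j ≠ k → c.topLevels (n k j) j (w j) = c.topLevels (n k j) j (w' j)) := by
  have hY : c.received n w k = c.received n w' k := by
    funext t
    have hdiv : c.received n w k t / 2 ^ d = c.received n w' k t / 2 ^ d := by
      simp only [Code.received]
      rw [output_div_two_pow n _ k e d hd hint, output_div_two_pow n _ k e d hd hint]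
      exact congrFun htop t
    rw [← Nat.div_add_mod (c.received n w k t) (2 ^ d), hdiv, hmod t, Nat.div_add_mod]
  have hk : w k = w' k := by rw [← hw, ← hw', hY]
  refine ⟨hk, fun hjk => ?_⟩
  -- The outputs agree and so do all summands except that of `j`, hence the latter agree as well.
  funext t
  refine fold_xor_cancel Finset.univ (fun i => ⌊(2 : ℝ) ^ n k i * (c.enc i (w i) t : ℝ)⌋₊)
    (fun i => ⌊(2 : ℝ) ^ n k i * (c.enc i (w' i) t : ℝ)⌋₊) (Finset.mem_univ j) ?_ (congrFun hY t)
  intro i _ hi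
  by_cases hik : i = k
  · subst hik
    simp only [hk]
  · simp only [hoff i hik hi]

open Classical in
/-- There are few message tuples that receiver `k` decodes correctly although the top levels of
transmitter `j` are too unlikely compared with those of transmitter `k`. -/
theorem Code.card_unlikely_le {K N : ℕ} {R : Fin K → ℝ} (c : Code K N R)
    {n : Fin K → Fin K → ℕ} {k j : Fin K} {e d : ℕ} (hd : n k k = e + d)
    (hint : ∀ i, i ≠ k → n k i ≤ d) {δ : ℝ} (hδ : 0 ≤ δ) :
    ((Finset.univ.filter fun w : (i : Fin K) → Fin (numMessages N (R i)) =>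
      c.dec k (c.received n w k) = w k ∧
        (c.fiberCard (edgeWeight n k j) j (w j) : ℝ) * (2 ^ d) ^ N ≤
          δ * numMessages N (R j) * c.fiberCard e k (w k)).card : ℝ) ≤
      δ * Fintype.card ((i : Fin K) → Fin (numMessages N (R i))) := by
  set B := Finset.univ.filter fun w : (i : Fin K) → Fin (numMessages N (R i)) =>
      c.dec k (c.received n w k) = w k ∧
        (c.fiberCard (edgeWeight n k j) j (w j) : ℝ) * (2 ^ d) ^ N ≤
          δ * numMessages N (R j) * c.fiberCard e k (w k) with hBdef
  -- If `j = k`, the entry `v` is overwritten by `u`. This is harmless, since the observed part of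
  -- `j` is then trivial.
  let up : ((i : Fin K) → Fin (numMessages N (R i))) → Fin (numMessages N (R k)) →
      Fin (numMessages N (R j)) → (i : Fin K) → Fin (numMessages N (R i)) :=
    fun w u v => Function.update (Function.update w j v) k u
  have hup_k : ∀ w u v, up w u v k = u := fun w u v => by simp [up]
  have hup_j : ∀ w u v, c.topLevels (edgeWeight n k j) j (up w u v j) =
      c.topLevels (edgeWeight n k j) j v := by
    intro w u v
    by_cases hjk : j = k
    · subst hjk
      simpa only [edgeWeight, if_true] using c.topLevels_zero _ _ _
    · simp [up, hjk]
  have hfib_j : ∀ w u v, c.fiberCard (edgeWeight n k j) j (up w u v j) =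
      c.fiberCard (edgeWeight n k j) j v := fun w u v => by
    rw [Code.fiberCard, hup_j, Code.fiberCard]
  have hpair : ∀ w, ∑ v, ∑ u, (if up w u v ∈ B then (1 : ℝ) else 0) ≤
      δ * numMessages N (R j) * numMessages N (R k) := by
    intro w
    let B' : Finset (Fin (numMessages N (R k)) × Fin (numMessages N (R j))) :=
      Finset.univ.filter fun p => up w p.1 p.2 ∈ B
    have hB' : ∀ p, p ∈ B' ↔ up w p.1 p.2 ∈ B := fun p => by simp [B']
    have hcard : ∑ v, ∑ u, (if up w u v ∈ B then (1 : ℝ) else 0) = B'.card := by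
      rw [Finset.sum_comm, ← Fintype.sum_prod_type'
        (f := fun u v => if up w u v ∈ B then (1 : ℝ) else 0), Finset.sum_boole]
    rw [hcard]
    have h := card_small_fiber_le (c.topLevels e k) (c.topLevels (edgeWeight n k j) j)
      (fun u v (t : Fin N) => (⟨c.received n (up w u v) k t % 2 ^ d,
        Nat.mod_lt _ (by positivity)⟩ : Fin (2 ^ d))) B' (c := δ * numMessages N (R j))
      (by positivity) ?_ ?_
    · simpa using h
    · intro p hp q hq hf hZ
      rw [hB', hBdef, Finset.mem_filter] at hp hq
      have h := c.eq_of_received_mod_eq (j := j) hd hint hp.2.1 hq.2.1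
        (fun i hik hij => by simp [up, hik, hij]) (by rw [hup_k, hup_k]; exact hf)
        (fun t => congrArg Fin.val (congrFun hZ t))
      rw [hup_k, hup_k] at h
      refine ⟨h.1, ?_⟩
      by_cases hjk : j = k
      · simpa only [edgeWeight, hjk.symm, if_true] using c.topLevels_zero _ _ _
      · rw [← hup_j w p.1 p.2, ← hup_j w q.1 q.2, edgeWeight, if_neg (Ne.symm hjk)]
        exact h.2 hjk
    · intro p hp
      rw [hB', hBdef, Finset.mem_filter, hfib_j, hup_k] at hp
      simpa [Code.fiberCard] using hp.2.2
  -- Resampling the messages of `j` and `k` counts every tuple of `B` exactly `numMessages N (R j) *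
  -- numMessages N (R k)` times.
  have hsum : ∑ w, ∑ v, ∑ u, (if up w u v ∈ B then (1 : ℝ) else 0) =
      numMessages N (R j) * (numMessages N (R k) * B.card) := by
    have h1 := sum_sum_update (α := fun i => Fin (numMessages N (R i))) j
      (fun w => ∑ u, if Function.update w k u ∈ B then (1 : ℝ) else 0)
    have h2 := sum_sum_update (α := fun i => Fin (numMessages N (R i))) k
      (fun w => if w ∈ B then (1 : ℝ) else 0)
    simp only [Fintype.card_fin] at h1 h2
    rw [h1, h2, Finset.sum_boole, Finset.filter_univ_mem]
  have hle := Finset.sum_le_sum fun w (_ : w ∈ Finset.univ) => hpair w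
  rw [hsum, Finset.sum_const, nsmul_eq_mul, Finset.card_univ] at hle
  have hj : (0 : ℝ) < numMessages N (R j) := by exact_mod_cast numMessages_pos N (R j)
  have hk : (0 : ℝ) < numMessages N (R k) := by exact_mod_cast numMessages_pos N (R k)
  refine le_of_mul_le_mul_left ?_ (mul_pos hj hk)
  linarith

open Classical in
theorem Code.card_error {K N : ℕ} {R : Fin K → ℝ} (c : Code K N R) (n : Fin K → Fin K → ℕ)
    (k : Fin K) :
    ((Finset.univ.filter fun w : (i : Fin K) → Fin (numMessages N (R i)) =>
      c.dec k (c.received n w k) ≠ w k).card : ℝ) =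
      c.errorProb n k * Fintype.card ((i : Fin K) → Fin (numMessages N (R i))) := by
  have : Nonempty ((i : Fin K) → Fin (numMessages N (R i))) :=
    ⟨fun i => ⟨0, numMessages_pos N (R i)⟩⟩
  have hpos : (0 : ℝ) < Fintype.card ((i : Fin K) → Fin (numMessages N (R i))) := by
    exact_mod_cast Fintype.card_pos
  rw [Code.errorProb, Nat.card_eq_fintype_card, Nat.card_eq_fintype_card,
    div_mul_cancel₀ _ hpos.ne', Fintype.card_subtype]

/-- A code of small error probability has few messages for the users of a cycle. -/
theorem Code.prod_numMessages_le {K N : ℕ} {R : Fin K → ℝ} (c : Code K N R)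
    {n : Fin K → Fin K → ℕ} (hn : TINOptimal n) (σ : Equiv.Perm (Fin K)) (S : Finset (Fin K))
    (hS : ∀ i ∈ S, σ i ∈ S) {δ : ℝ} (hδ : 0 < δ) (hδK : 2 * K * δ < 1)
    (herr : ∀ k, c.errorProb n k ≤ δ) :
    δ ^ S.card * ∏ k ∈ S, (numMessages N (R k) : ℝ) ≤
      ∏ k ∈ S, ((2 : ℝ) ^ (n k k - edgeWeight n (σ.symm k) k)) ^ N := by
  classical
  let e : Fin K → ℕ := fun k => edgeWeight n (σ.symm k) k
  let d : Fin K → ℕ := fun k => n k k - e k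
  have hd : ∀ k, n k k = e k + d k := fun k => by
    have : e k ≤ n k k := hn.edgeWeight_le _ _
    simp only [d]
    omega
  have hint : ∀ k i, i ≠ k → n k i ≤ d k := fun k i hi => by
    have : e k + n k i ≤ n k k := hn.edgeWeight_add_le _ hi
    simp only [d]
    omega
  let Ω := (i : Fin K) → Fin (numMessages N (R i))
  have : Nonempty Ω := ⟨fun i => ⟨0, numMessages_pos N (R i)⟩⟩
  have hΩ : (0 : ℝ) < Fintype.card Ω := by exact_mod_cast Fintype.card_pos
  let E : Fin K → Finset Ω := fun k => Finset.univ.filter fun w =>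
    c.dec k (c.received n w k) ≠ w k
  let U : Fin K → Finset Ω := fun k => Finset.univ.filter fun w =>
    c.dec k (c.received n w k) = w k ∧
        (c.fiberCard (edgeWeight n k (σ k)) (σ k) (w (σ k)) : ℝ) * (2 ^ d k) ^ N ≤
          δ * numMessages N (R (σ k)) * c.fiberCard (e k) k (w k)
  have hEU : ∀ k, ((E k ∪ U k).card : ℝ) ≤ 2 * δ * Fintype.card Ω := by
    intro k
    have h1 : ((E k).card : ℝ) ≤ δ * Fintype.card Ω := by
      have h := c.card_error n k
      simp only [E, Ω]
      rw [h]
      exact mul_le_mul_of_nonneg_right (herr k) hΩ.le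
    have h2 : ((U k).card : ℝ) ≤ δ * Fintype.card Ω :=
      c.card_unlikely_le (hd k) (hint k) hδ.le
    have h3 : ((E k ∪ U k).card : ℝ) ≤ (E k).card + (U k).card := by
      exact_mod_cast Finset.card_union_le _ _
    linarith
  -- Union bound: the `2 * K` bad sets each have proportion at most `δ`, and `2 * K * δ < 1`.
  obtain ⟨w, hw⟩ : ∃ w : Ω, ∀ k, w ∉ E k ∪ U k := by
    by_contra! hcon
    have hall : (Finset.univ : Finset Ω) ⊆ Finset.univ.biUnion fun k => E k ∪ U k := by
      intro w _
      obtain ⟨k, hk⟩ := hcon w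
      exact Finset.mem_biUnion.2 ⟨k, Finset.mem_univ k, hk⟩
    have h1 : (Fintype.card Ω : ℝ) ≤ ∑ k, ((E k ∪ U k).card : ℝ) := by
      exact_mod_cast (Finset.card_le_card hall).trans Finset.card_biUnion_le
    have h2 : ∑ k, ((E k ∪ U k).card : ℝ) ≤ ∑ _k : Fin K, 2 * δ * Fintype.card Ω :=
      Finset.sum_le_sum fun k _ => hEU k
    rw [Finset.sum_const, nsmul_eq_mul, Finset.card_univ, Fintype.card_fin] at h2
    nlinarith
  -- Up to the factor `numMessages N (R k)`, `a k` is the probability of the top levels that user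
  -- `k` sends in the good tuple.
  let a : Fin K → ℝ := fun k => c.fiberCard (e k) k (w k)
  have ha : ∀ k, 0 < a k := fun k =>
    Nat.cast_pos.2 (c.fiberCard_pos (e k) k (w k))
  have hstep : ∀ k, δ * (numMessages N (R (σ k)) * a k) ≤ a (σ k) * (2 ^ d k) ^ N := by
    intro k
    have h := hw k
    simp only [E, U, Finset.mem_union, Finset.mem_filter, Finset.mem_univ, true_and, not_or,
      not_not, not_and, not_le] at h
    have h2 := (h.2 h.1).le
    have he : e (σ k) = edgeWeight n k (σ k) := by simp [e]
    simp only [a, he]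
    linarith
  have hinv : ∀ f : Fin K → ℝ, ∏ k ∈ S, f (σ k) = ∏ k ∈ S, f k := by
    intro f
    refine Finset.prod_bij (fun k _ => σ k) hS (fun _ _ _ _ h => σ.injective h) ?_
      fun _ _ => rfl
    intro b hb
    obtain ⟨x, hx, hxb⟩ := Finset.surjOn_of_injOn_of_card_le σ hS σ.injective.injOn le_rfl hb
    exact ⟨x, hx, hxb⟩
  have hprod := Finset.prod_le_prod (s := S)
    (fun k _ => mul_nonneg hδ.le (mul_nonneg (Nat.cast_nonneg _) (ha k).le))
    (fun k _ => hstep k)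
  -- Since `σ` permutes `S`, the products of `a k` and of `a (σ k)` coincide and cancel: this is the
  -- telescoping around the cycle.
  rw [Finset.prod_mul_distrib, Finset.prod_mul_distrib, Finset.prod_mul_distrib,
    Finset.prod_const, hinv a, hinv fun k => (numMessages N (R k) : ℝ)] at hprod
  refine le_of_mul_le_mul_left ?_ (Finset.prod_pos fun k (_ : k ∈ S) => ha k)
  linarith

/-- Taking logarithms in `Code.prod_numMessages_le` bounds `N` times the excess rate by a constant
independent of `N`, so the excess cannot be positive. -/
theorem Achievable.sum_le {K : ℕ} {n : Fin K → Fin K → ℕ} (hn : TINOptimal n) {R : Fin K → ℝ}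
    (hR : Achievable n R) (σ : Equiv.Perm (Fin K)) (S : Finset (Fin K))
    (hS : ∀ i ∈ S, σ i ∈ S) :
    ∑ k ∈ S, R k ≤ ∑ k ∈ S, ((n k k - edgeWeight n (σ.symm k) k : ℕ) : ℝ) := by
  obtain ⟨-, c, hc⟩ := hR
  set D := ∑ k ∈ S, ((n k k - edgeWeight n (σ.symm k) k : ℕ) : ℝ) with hD
  -- Any fixed `δ` with `2 * K * δ < 1` would do. It need not tend to zero, because its contribution
  -- to the rate is divided by `N`.
  let δ : ℝ := 1 / (2 * K + 1)
  have hδ : 0 < δ := by positivity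
  have hδK : 2 * K * δ < 1 := by
    simp only [δ]
    rw [mul_one_div, div_lt_one (by positivity)]
    linarith
  have hev : ∀ᶠ N in atTop, ∀ k, (c N).errorProb n k ≤ δ :=
    eventually_all.2 fun k => (hc k).eventually_le_const hδ
  have hbound : ∀ᶠ N : ℕ in atTop,
      (N : ℝ) * (∑ k ∈ S, R k - D) ≤ -Real.logb 2 (δ ^ S.card) := by
    filter_upwards [hev] with N hN
    have h := (c N).prod_numMessages_le hn σ S hS hδ hδK hN
    have h1 : (2 : ℝ) ^ ((N : ℝ) * ∑ k ∈ S, R k) ≤ ∏ k ∈ S, (numMessages N (R k) : ℝ) := by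
      rw [Finset.mul_sum, Real.rpow_sum_of_pos (by norm_num)]
      exact Finset.prod_le_prod (fun k _ => by positivity) fun k _ => Nat.le_ceil _
    have h2 : ∏ k ∈ S, ((2 : ℝ) ^ (n k k - edgeWeight n (σ.symm k) k)) ^ N =
        (2 : ℝ) ^ ((N : ℝ) * D) := by
      rw [hD, Finset.mul_sum, Real.rpow_sum_of_pos (by norm_num)]
      refine Finset.prod_congr rfl fun k _ => ?_
      rw [← pow_mul, ← Real.rpow_natCast]
      push_cast
      rw [mul_comm]
    have h3 : δ ^ S.card * (2 : ℝ) ^ ((N : ℝ) * ∑ k ∈ S, R k) ≤ (2 : ℝ) ^ ((N : ℝ) * D) := by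
      rw [← h2]
      exact (mul_le_mul_of_nonneg_left h1 (by positivity)).trans h
    have h4 := Real.logb_le_logb_of_le (b := 2) (by norm_num) (by positivity) h3
    rw [Real.logb_mul (by positivity) (by positivity),
      Real.logb_rpow (by norm_num) (by norm_num),
      Real.logb_rpow (by norm_num) (by norm_num)] at h4
    linarith
  by_contra! hlt
  have htop : Tendsto (fun N : ℕ => (N : ℝ) * (∑ k ∈ S, R k - D)) atTop atTop :=
    tendsto_natCast_atTop_atTop.atTop_mul_const (sub_pos.2 hlt)
  obtain ⟨N, hN, hN'⟩ := (hbound.and (htop.eventually_gt_atTop _)).exists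
  exact absurd hN hN'.not_ge

theorem UserCycle.next_mem {K : ℕ} (p : UserCycle K) {i : Fin K} (hi : i ∈ p.users) :
    p.next i ∈ p.users := by
  obtain ⟨s, hs, hne⟩ := p
  induction s using Quotient.inductionOn with
  | _ l =>
    simp only [UserCycle.users, UserCycle.next] at hi ⊢
    have hi' : i ∈ l := by simpa using hi
    have hnext : l.formPerm i ∈ l := List.formPerm_apply_mem_of_mem hi'
    exact Multiset.mem_toFinset.2 hnext

/-- Each cycle is invariant under its own `formPerm`, so the bounds can be proved cycle by cycle and
added; no permutation has to be assembled from the partition. -/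
theorem Achievable.sum_le_cyclicPartitionBound {K : ℕ} {n : Fin K → Fin K → ℕ}
    (hn : TINOptimal n) {R : Fin K → ℝ} (hR : Achievable n R) (P : CyclicPartition K) :
    ∑ k, R k ≤ cyclicPartitionBound n P := by
  have hcyc : ∀ p : UserCycle K,
      ∑ k ∈ p.users, R k ≤ ∑ k ∈ p.users, (n k k : ℝ) - (p.weight n : ℝ) := by
    intro p
    let σ : Equiv.Perm (Fin K) := p.1.formPerm p.2.1
    have hS : ∀ i ∈ p.users, σ i ∈ p.users := fun i hi => p.next_mem hi
    refine (hR.sum_le hn σ p.users hS).trans_eq ?_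
    have hw : (p.weight n : ℝ) = ∑ k ∈ p.users, (edgeWeight n (σ.symm k) k : ℝ) := by
      rw [UserCycle.weight, Nat.cast_sum]
      refine Finset.sum_bij (fun k _ => σ k) hS (fun _ _ _ _ h => σ.injective h) ?_ ?_
      · intro b hb
        obtain ⟨x, hx, hxb⟩ := Finset.surjOn_of_injOn_of_card_le σ hS σ.injective.injOn le_rfl hb
        exact ⟨x, hx, hxb⟩
      · intro k _
        rw [Equiv.symm_apply_apply]
        rfl
    rw [hw, ← Finset.sum_sub_distrib]
    exact Finset.sum_congr rfl fun k _ => Nat.cast_sub (hn.edgeWeight_le _ _)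
  rw [cyclicPartitionBound, CyclicPartition.weight, ← P.sum_cycles R,
    ← P.sum_cycles fun k => (n k k : ℝ), Nat.cast_sum, ← Finset.sum_sub_distrib]
  exact Finset.sum_le_sum fun p _ => hcyc p

theorem sum_le_cyclicPartitionBound_of_mem_capacityRegion {K : ℕ} {n : Fin K → Fin K → ℕ}
    (hn : TINOptimal n) {R : Fin K → ℝ} (hR : R ∈ capacityRegion n) (P : CyclicPartition K) :
    ∑ k, R k ≤ cyclicPartitionBound n P := by
  have hclosed : IsClosed {R : Fin K → ℝ | ∑ k, R k ≤ cyclicPartitionBound n P} :=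
    isClosed_le (by fun_prop) continuous_const
  exact closure_minimal (fun R hR => Achievable.sum_le_cyclicPartitionBound hn hR P) hclosed hR

theorem bestCyclicPartitionBound_eq {K : ℕ} (n : Fin K → Fin K → ℕ) :
    bestCyclicPartitionBound n = (∑ k, (n k k : ℝ)) - (maxCyclicPartitionWeight n : ℝ) := by
  refine le_antisymm ?_ (Finset.le_inf' _ _ fun P hP => ?_)
  · obtain ⟨P, hP, hmax⟩ := Finset.exists_mem_eq_sup' (Finset.univ_nonempty)
      (fun P : CyclicPartition K => P.weight n)
    rw [maxCyclicPartitionWeight, hmax]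
    exact Finset.inf'_le _ hP
  · have h : P.weight n ≤ maxCyclicPartitionWeight n :=
      Finset.le_sup' (fun P : CyclicPartition K => P.weight n) hP
    have h' : (P.weight n : ℝ) ≤ maxCyclicPartitionWeight n := by exact_mod_cast h
    rw [cyclicPartitionBound]
    linarith

theorem isGreatest_sumRates {K : ℕ} (n : Fin K → Fin K → ℕ) (hn : TINOptimal n) :
    IsGreatest (sumRates n) (bestCyclicPartitionBound n) := by
  have hub : ∀ R ∈ capacityRegion n, ∑ k, R k ≤ bestCyclicPartitionBound n := fun R hR =>
    Finset.le_inf' _ _ fun P _ => sum_le_cyclicPartitionBound_of_mem_capacityRegion hn hR P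
  refine ⟨?_, by rintro _ ⟨R, hR, rfl⟩; exact hub R hR⟩
  obtain ⟨σ, R, hR, hle⟩ := exists_perm_achievable n hn
  have hmem : R ∈ capacityRegion n := subset_closure hR
  -- The achieved sum-rate is at least the bound of one particular partition, hence at least the
  -- minimum, and the converse forces equality.
  refine ⟨R, hmem, le_antisymm (hub R hmem) (le_trans ?_ hle)⟩
  rw [← weight_partitionOfPerm]
  exact Finset.inf'_le _ (Finset.mem_univ (partitionOfPerm σ))

end ADT

/-- For a TIN optimal network the maximum of the sum-rate over the capacity region exists, it is
the best cyclic partition bound, and this bound is the sum of the desired link strengths minus the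
maximum weight of a cyclic partition. -/
theorem corollary1 {K : ℕ} (n : Fin K → Fin K → ℕ) (hn : ADT.TINOptimal n) :
    IsGreatest (ADT.sumRates n) (ADT.sumCapacity n) ∧
      ADT.sumCapacity n = ADT.bestCyclicPartitionBound n ∧
      ADT.bestCyclicPartitionBound n =
        (∑ k, (n k k : ℝ)) - (ADT.maxCyclicPartitionWeight n : ℝ) := by
  have h := ADT.isGreatest_sumRates n hn
  have heq : ADT.sumCapacity n = ADT.bestCyclicPartitionBound n := h.csSup_eq
  exact ⟨heq ▸ h, heq, ADT.bestCyclicPartitionBound_eq n⟩
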